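/- All algebras are complex vector spaces with a bilinear, not necessarily associative, product. For $\delta\in\mathbb C$, an algebra is called \emph{$\delta$-Novikov} if for all $x,y,z$ $$\delta\,(xy)z-x(yz)=\delta\,(yx)z-y(xz)\qquad\text{and}\qquad (xy)z=(xz)y .$$ \textbf{Theorem.} Let $\delta\in\mathbb C$ and let $N$ be a $2$-dimensional $\delta$-Novikov algebra with nonzero multiplication. Then $N$ is isomorphic to one of the following algebras with basis $e_1,e_2$ whose mark (second column) admits $\delta$ (products of basis vectors that are not written are zero): $$\begin{array}{lll} \mathbf N_{01} & 1 & e_1e_1=e_1+e_2,\ e_2e_1=e_2\\ \mathbf N_{02} & \text{every }\delta & e_1e_1=e_2\\ \mathbf N_{03} & 0 & e_1e_2=e_1\\ \mathbf N_{04} & \text{every }\delta & e_2e_1=e_1\\ \mathbf N_{05} & 0 & e_1e_1=e_1,\ e_1e_2=e_1\\ \mathbf N_{06} & 0 & e_1e_1=e_1,\ e_2e_1=e_1\\ \mathbf N_{07} & \text{every }\delta & e_1e_1=e_1\\ \mathbf N_{08}^{\gamma}\ (\gamma\neq 0) & \gamma & e_1e_1=e_1,\ e_2e_1=\gamma^{-1}e_2\\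 \mathbf N_{09} & \text{every }\delta & e_1e_1=e_1,\ e_1e_2=e_2,\ e_2e_1=e_2\\ \mathbf N_{10}^{\alpha}\ (\alpha\neq 1) & 1 & e_1e_1=e_1,\ e_1e_2=\alpha e_2,\ e_2e_1=e_2\\ \mathbf N_{11} & \text{every }\delta & e_1e_1=e_1,\ e_2e_2=e_2\\ \mathbf N_{12} & -1 & e_1e_1=e_1,\ e_1e_2=-e_1,\ e_2e_1=-e_2,\ e_2e_2=e_2 \end{array}$$ Each listed algebra is $\gamma$-Novikov for precisely those $\gamma\in\mathbb C$ that its mark admits. (The list is not claimed to be free of repetitions up to isomorphism.) In particular, $\mathbf N_{12}$ is a non-commutative anti-Novikov algebra (that is, $(-1)$-Novikov), and it is simple: its multiplication is nonzero and it has no two-sided ideals other than $0$ and itself. -/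

import Mathlib

namespace DeltaNovikov

universe u v

/-- A complex (non-associative) algebra is a (left) `δ`-Novikov algebra if it is `δ`-left-symmetric
and right commutative. -/
structure IsDeltaNovikov (δ : ℂ) (A : Type u) [NonUnitalNonAssocRing A] [Module ℂ A] : Prop where
  left_symm : ∀ x y z : A, δ • (x * y * z) - x * (y * z) = δ • (y * x * z) - y * (x * z)
  right_comm : ∀ x y z : A, x * y * z = x * z * y

/-- Isomorphism of complex (non-associative) algebras: a bijective homomorphism. -/
def Isomorphic (A : Type u) (B : Type v) [NonUnitalNonAssocRing A] [Module ℂ A]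
    [NonUnitalNonAssocRing B] [Module ℂ B] : Prop :=
  ∃ f : A →ₙₐ[ℂ] B, Function.Bijective f

/-- A complex (non-associative) algebra is simple if its multiplication is nonzero and it has no
two-sided ideals (which are linear subspaces) other than `0` and itself. -/
structure IsSimpleAlg (A : Type u) [NonUnitalNonAssocRing A] [Module ℂ A] : Prop where
  mul_ne_zero : ∃ x y : A, x * y ≠ 0
  ideal_eq : ∀ I : Submodule ℂ A,
    (∀ x ∈ I, ∀ a : A, a * x ∈ I ∧ x * a ∈ I) → I = ⊥ ∨ I = ⊤

/-- The complex vector space `ℂ²` with the bilinear product for which the product of the `i`-th and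
the `j`-th standard basis vector is the entry `T i j` of the multiplication table `T`. -/
def TableAlg (_T : Matrix (Fin 2) (Fin 2) (Fin 2 → ℂ)) : Type := Fin 2 → ℂ

namespace TableAlg

variable (T : Matrix (Fin 2) (Fin 2) (Fin 2 → ℂ))

instance : AddCommGroup (TableAlg T) := inferInstanceAs (AddCommGroup (Fin 2 → ℂ))

instance : Module ℂ (TableAlg T) := inferInstanceAs (Module ℂ (Fin 2 → ℂ))

instance : Mul (TableAlg T) :=
  ⟨fun x y => (fun k => ∑ i : Fin 2, ∑ j : Fin 2, x i * y j * T i j k : Fin 2 → ℂ)⟩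

theorem mul_apply (x y : TableAlg T) (k : Fin 2) :
    (x * y) k = ∑ i : Fin 2, ∑ j : Fin 2, x i * y j * T i j k := rfl

theorem add_apply (x y : TableAlg T) (k : Fin 2) : (x + y) k = x k + y k := rfl

theorem zero_apply (k : Fin 2) : (0 : TableAlg T) k = 0 := rfl

theorem smul_apply (c : ℂ) (x : TableAlg T) (k : Fin 2) : (c • x) k = c * x k := rfl

instance : NonUnitalNonAssocRing (TableAlg T) :=
  { (inferInstance : AddCommGroup (TableAlg T)), (inferInstance : Mul (TableAlg T)) with
    left_distrib := fun x y z => by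
      funext k; simp only [mul_apply, add_apply, Fin.sum_univ_two]; ring
    right_distrib := fun x y z => by
      funext k; simp only [mul_apply, add_apply, Fin.sum_univ_two]; ring
    zero_mul := fun x => by
      funext k; simp only [mul_apply, zero_apply, Fin.sum_univ_two]; ring
    mul_zero := fun x => by
      funext k; simp only [mul_apply, zero_apply, Fin.sum_univ_two]; ring }

instance : IsScalarTower ℂ (TableAlg T) (TableAlg T) :=
  ⟨fun c x y => by
    funext k; simp only [smul_eq_mul, mul_apply, smul_apply, Fin.sum_univ_two]; ring⟩

instance : SMulCommClass ℂ (TableAlg T) (TableAlg T) :=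
  ⟨fun c x y => by
    funext k; simp only [smul_eq_mul, mul_apply, smul_apply, Fin.sum_univ_two]; ring⟩

end TableAlg

/-- The first standard basis vector of `ℂ²`. -/
def e₁ : Fin 2 → ℂ := ![1, 0]

/-- The second standard basis vector of `ℂ²`. -/
def e₂ : Fin 2 → ℂ := ![0, 1]

/-- The entries of the list: twelve lines, two of which are one-parameter families. -/
inductive Entry : Type
  | N01 | N02 | N03 | N04 | N05 | N06 | N07
  | N08 (γ : ℂ) (hγ : γ ≠ 0)
  | N09
  | N10 (α : ℂ) (hα : α ≠ 1)
  | N11 | N12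

namespace Entry

/-- The multiplication table `!![e₁e₁, e₁e₂; e₂e₁, e₂e₂]` of an entry. -/
noncomputable def table : Entry → Matrix (Fin 2) (Fin 2) (Fin 2 → ℂ)
  | N01 => !![e₁ + e₂, 0; e₂, 0]
  | N02 => !![e₂, 0; 0, 0]
  | N03 => !![0, e₁; 0, 0]
  | N04 => !![0, 0; e₁, 0]
  | N05 => !![e₁, e₁; 0, 0]
  | N06 => !![e₁, 0; e₁, 0]
  | N07 => !![e₁, 0; 0, 0]
  | N08 γ _ => !![e₁, 0; γ⁻¹ • e₂, 0]
  | N09 => !![e₁, e₂; e₂, 0]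
  | N10 α _ => !![e₁, α • e₂; e₂, 0]
  | N11 => !![e₁, 0; 0, e₂]
  | N12 => !![e₁, -e₁; -e₂, e₂]

/-- The set of those `δ` with which an entry is marked. -/
def mark : Entry → Set ℂ
  | N01 => {1}
  | N02 => Set.univ
  | N03 => {0}
  | N04 => Set.univ
  | N05 => {0}
  | N06 => {0}
  | N07 => Set.univ
  | N08 γ _ => {γ}
  | N09 => Set.univ
  | N10 _ _ => {1}
  | N11 => Set.univ
  | N12 => {-1}

/-- The two-dimensional complex algebra of an entry. -/
abbrev Alg (E : Entry) : Type := TableAlg E.table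

end Entry

end DeltaNovikov

/-!
In a `δ`-Novikov algebra the right multiplications `x ↦ x * y` commute. In dimension two this leaves
two possibilities (`exists_basis_diagonal_or_jordan`): there is a basis `u, v` in which either all
of them are diagonal, or each of them has the form `u ↦ p • u + q • v`, `v ↦ p • v`. Here it is
used that `ℂ` is algebraically closed.

As `y` runs over the basis, the coefficients give four structure constants `a, b, c, d`, and
`δ`-left symmetry need only be imposed on the triples `(u, v, u)` and `(u, v, v)`. It becomes a
short system of polynomial equations in `a, b, c, d, δ`, whose nonzero solutions are brought
into the listed forms by explicit changes of basis (`classification_diagonal`,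
`classification_jordan`, with `isomorphic_tableAlg_of_linearIndependent` to produce the
isomorphisms).

That each entry is `γ`-Novikov exactly for the values `γ` of its mark is a computation in
coordinates. The last entry has the product `x * y = (y 0 - y 1) • (x 0, -x 1)`; a nonzero ideal
contains a vector with different coordinates (if `x` is not one, then `x * e₁` is), and the left
multiples of such a vector are the whole algebra.
-/

namespace DeltaNovikov

section Basis

variable {N : Type*} [NonUnitalNonAssocRing N] [Module ℂ N] [IsScalarTower ℂ N N]

/-! ### Right multiplications -/

/-- The right multiplications of an algebra satisfying `(x * y) * z = (x * z) * y` commute with one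
another. Unless they are all scalar, one of them, `R`, is cyclic, so that all of them are
polynomials in `R` and take the diagonal or the Jordan form in the basis in which `R` does. -/
theorem exists_basis_diagonal_or_jordan {δ : ℂ} (hd : Module.finrank ℂ N = 2)
    (hN : IsDeltaNovikov δ N) :
    ∃ u v : N, LinearIndependent ℂ ![u, v] ∧
      ((∀ y, ∃ p q : ℂ, u * y = p • u ∧ v * y = q • v) ∨
        ∀ y, ∃ p q : ℂ, u * y = p • u + q • v ∧ v * y = p • v) := by
  have hfin : Module.Finite ℂ N := Module.finite_of_finrank_eq_succ hd
  have hspan {u v : N} (h : LinearIndependent ℂ ![u, v]) (x : N) :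
      ∃ p q : ℂ, x = p • u + q • v := by
    have hx : x ∈ Submodule.span ℂ (Set.range ![u, v]) := by
      rw [h.span_eq_top_of_card_eq_finrank (by simp [hd])]
      trivial
    simp only [Matrix.range_cons, Matrix.range_empty, Set.union_empty,
      Set.singleton_union, Submodule.mem_span_pair] at hx
    obtain ⟨p, q, h⟩ := hx
    exact ⟨p, q, h.symm⟩
  by_cases hcyc : ∃ x w : N, LinearIndependent ℂ ![x, x * w]
  · obtain ⟨x, w, hx⟩ := hcyc
    obtain ⟨m, t, ht⟩ := hspan hx (x * w * w)
    -- `r` and `s` are the eigenvalues of right multiplication by `w`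
    obtain ⟨r, hr⟩ : ∃ r : ℂ, r * r - t * r - m = 0 := by
      obtain ⟨r, hr⟩ := exists_quadratic_eq_zero (b := -t) (c := -m) one_ne_zero
        (IsAlgClosed.exists_eq_mul_self _)
      exact ⟨r, by linear_combination hr⟩
    obtain ⟨s, rfl⟩ : ∃ s, t = r + s := ⟨t - r, by ring⟩
    obtain rfl : m = -(r * s) := by linear_combination -hr
    -- every right multiplication is a polynomial in right multiplication by `w`
    have hy (y : N) : ∃ p q : ℂ, x * y = p • x + q • (x * w) ∧
        x * w * y = p • (x * w) + q • (x * w * w) := by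
      obtain ⟨p, q, h⟩ := hspan hx (x * y)
      refine ⟨p, q, h, ?_⟩
      rw [hN.right_comm, h, add_mul, smul_mul_assoc, smul_mul_assoc]
    by_cases hrs : r = s
    · subst hrs
      refine ⟨x, (-r) • x + x * w, ?_, Or.inr fun y => ?_⟩
      · exact (LinearIndependent.pair_add_smul_right_iff (-r)).2 hx
      · obtain ⟨p, q, h₁, h₂⟩ := hy y
        refine ⟨p + q * r, q, ?_, ?_⟩
        · rw [h₁]; module
        · rw [add_mul, smul_mul_assoc, h₁, h₂, ht]; module
    · refine ⟨(-s) • x + (1 : ℂ) • (x * w), (-r) • x + (1 : ℂ) • (x * w), ?_, Or.inl fun y => ?_⟩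
      · refine (LinearIndependent.pair_add_smul_add_smul_iff _ _ _ _).2 ⟨hx, ?_⟩
        simpa [eq_comm] using hrs
      · obtain ⟨p, q, h₁, h₂⟩ := hy y
        refine ⟨p + q * r, p + q * s, ?_, ?_⟩
        · rw [add_mul, smul_mul_assoc, smul_mul_assoc, h₁, h₂, ht]; module
        · rw [add_mul, smul_mul_assoc, smul_mul_assoc, h₁, h₂, ht]; module
  · push Not at hcyc
    have b : Module.Basis (Fin 2) ℂ N := Module.finBasisOfFinrankEq ℂ N hd
    have hb : LinearIndependent ℂ ![b 0, b 1] := by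
      convert b.linearIndependent using 1
      funext i; fin_cases i <;> rfl
    have hscal (x y : N) (hx : x ≠ 0) : ∃ p : ℂ, x * y = p • x := by
      have := hcyc x y
      rw [LinearIndependent.pair_iff' hx] at this
      push Not at this
      obtain ⟨p, hp⟩ := this
      exact ⟨p, hp.symm⟩
    refine ⟨b 0, b 1, hb, Or.inl fun y => ?_⟩
    obtain ⟨p, hp⟩ := hscal (b 0) y (b.ne_zero 0)
    obtain ⟨q, hq⟩ := hscal (b 1) y (b.ne_zero 1)
    exact ⟨p, q, hp, hq⟩

variable [SMulCommClass ℂ N N]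

/-! ### Multiplication tables and isomorphisms -/

/-- An algebra is isomorphic to the one given by the table of structure constants in any of its
bases. -/
theorem isomorphic_tableAlg_of_linearIndependent (hd : Module.finrank ℂ N = 2) {f₁ f₂ : N}
    (hf : LinearIndependent ℂ ![f₁, f₂]) (T : Matrix (Fin 2) (Fin 2) (Fin 2 → ℂ))
    (h₁₁ : f₁ * f₁ = T 0 0 0 • f₁ + T 0 0 1 • f₂) (h₁₂ : f₁ * f₂ = T 0 1 0 • f₁ + T 0 1 1 • f₂)
    (h₂₁ : f₂ * f₁ = T 1 0 0 • f₁ + T 1 0 1 • f₂) (h₂₂ : f₂ * f₂ = T 1 1 0 • f₁ + T 1 1 1 • f₂) :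
    Isomorphic N (TableAlg T) := by
  let b := basisOfLinearIndependentOfCardEqFinrank hf (by simp [hd])
  have hb : ⇑b = ![f₁, f₂] := coe_basisOfLinearIndependentOfCardEqFinrank hf _
  let φ : N ≃ₗ[ℂ] (Fin 2 → ℂ) := b.equivFun
  have hφ (x : N) : x = φ x 0 • f₁ + φ x 1 • f₂ := by
    conv_lhs => rw [← b.sum_equivFun x]
    simp [hb, φ]
  have hφ' (u v : ℂ) : φ (u • f₁ + v • f₂) = ![u, v] := by
    have : u • f₁ + v • f₂ = φ.symm ![u, v] := by simp [φ, Module.Basis.equivFun_symm_apply, hb]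
    rw [this, LinearEquiv.apply_symm_apply]
  have hmul (x y : N) : φ (x * y) =
      fun k => ∑ i : Fin 2, ∑ j : Fin 2, φ x i * φ y j * T i j k := by
    conv_lhs => rw [hφ x, hφ y]
    have : (φ x 0 • f₁ + φ x 1 • f₂) * (φ y 0 • f₁ + φ y 1 • f₂) =
        (∑ i : Fin 2, ∑ j : Fin 2, φ x i * φ y j * T i j 0) • f₁ +
        (∑ i : Fin 2, ∑ j : Fin 2, φ x i * φ y j * T i j 1) • f₂ := by
      simp only [add_mul, mul_add, smul_mul_assoc, mul_smul_comm, h₁₁, h₁₂, h₂₁, h₂₂,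
        Fin.sum_univ_two]
      module
    rw [this, hφ']
    funext k
    fin_cases k <;> rfl
  exact ⟨{ toFun := φ, map_smul' := φ.map_smul, map_zero' := φ.map_zero, map_add' := φ.map_add,
           map_mul' := hmul }, φ.bijective⟩

theorem mul_eq_zero_of_basis (hd : Module.finrank ℂ N = 2) {u v : N}
    (he : LinearIndependent ℂ ![u, v]) (h₁₁ : u * u = 0) (h₁₂ : u * v = 0)
    (h₂₁ : v * u = 0) (h₂₂ : v * v = 0) (x y : N) : x * y = 0 := by
  obtain ⟨f, hf⟩ := isomorphic_tableAlg_of_linearIndependent hd he 0 (by simp [h₁₁])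
    (by simp [h₁₂]) (by simp [h₂₁]) (by simp [h₂₂])
  refine hf.1 ?_
  rw [map_mul, map_zero]
  funext k
  simp [TableAlg.mul_apply, TableAlg.zero_apply]

/-- Diagonal multiplication with `uv ≠ 0`. -/
theorem classification_diagonal_of_ne_zero {δ : ℂ} (hd : Module.finrank ℂ N = 2)
    {u v : N} (he : LinearIndependent ℂ ![u, v])
    {a b c d : ℂ} (h₁₁ : u * u = a • u) (h₁₂ : u * v = b • u) (h₂₁ : v * u = c • v)
    (h₂₂ : v * v = d • v) (hb : b ≠ 0) (hc : c = δ * a) (hd' : d = δ * b)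
    (hca : δ * a * (δ - 1) * (δ + 1) = 0) :
    ∃ E : Entry, δ ∈ E.mark ∧ Isomorphic N E.Alg := by
  have key (p q r s : ℂ) (h : p * s ≠ q * r) := isomorphic_tableAlg_of_linearIndependent hd
    ((LinearIndependent.pair_add_smul_add_smul_iff p q r s).2 ⟨he, h⟩)
  simp only [add_mul, mul_add, smul_mul_assoc, mul_smul_comm, h₁₁, h₁₂, h₂₁, h₂₂] at key
  subst hc hd'
  by_cases hδ : δ = 0
  · subst hδ
    by_cases ha : a = 0
    · subst ha
      refine ⟨.N03, rfl, key 1 0 0 b⁻¹ (by simpa) _ ?_ ?_ ?_ ?_⟩ <;>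
      simp [Entry.table, e₁] <;> match_scalars <;> field_simp
    · refine ⟨.N05, rfl, key a⁻¹ 0 0 b⁻¹ (by simp [ha, hb]) _ ?_ ?_ ?_ ?_⟩ <;>
      simp [Entry.table, e₁] <;> match_scalars <;> field_simp
  by_cases ha : a = 0
  · subst ha
    refine ⟨.N08 δ hδ, rfl, key 0 (δ * b)⁻¹ 1 0 (by simp [hδ, hb]) _ ?_ ?_ ?_ ?_⟩ <;>
    simp [Entry.table, e₁, e₂] <;> match_scalars <;> field_simp
  have hδ' : δ = 1 ∨ δ = -1 := by
    simpa [hδ, ha, sub_eq_zero, add_eq_zero_iff_eq_neg] using hca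
  rcases hδ' with rfl | rfl
  · -- here `x * y = l(y) x` with a linear form `l`; `b • u - a • v` spans its kernel
    refine ⟨.N08 1 one_ne_zero, rfl, key a⁻¹ 0 b (-a) (by simp [ha]) _ ?_ ?_ ?_ ?_⟩ <;>
    simp [Entry.table, e₁, e₂] <;> match_scalars <;> field_simp <;> ring
  · refine ⟨.N12, rfl, key a⁻¹ 0 0 (-b⁻¹) (by simp [ha, hb]) _ ?_ ?_ ?_ ?_⟩ <;>
    simp [Entry.table, e₁, e₂] <;> match_scalars <;> field_simp

/-- Algebras in which all right multiplications are diagonal in a common basis. The case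
`b = 0 ≠ c` reduces to `b ≠ 0` by exchanging the basis vectors. -/
theorem classification_diagonal {δ : ℂ} (hd : Module.finrank ℂ N = 2)
    (hN : IsDeltaNovikov δ N) (h0 : ∃ x y : N, x * y ≠ 0)
    {u v : N} (he : LinearIndependent ℂ ![u, v])
    {a b c d : ℂ} (h₁₁ : u * u = a • u) (h₁₂ : u * v = b • u) (h₂₁ : v * u = c • v)
    (h₂₂ : v * v = d • v) :
    ∃ E : Entry, δ ∈ E.mark ∧ Isomorphic N E.Alg := by
  have he' := LinearIndependent.pair_iff.1 he
  obtain ⟨h1, h2⟩ := he' (δ * b * a - b * c) (c * a - δ * c * c) (by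
    have := hN.left_symm u v u
    simp only [smul_mul_assoc, mul_smul_comm, h₁₁, h₁₂, h₂₁] at this
    rw [← sub_eq_zero] at this
    rw [← this]; module)
  obtain ⟨h3, h4⟩ := he' (δ * b * b - b * d) (c * b - δ * c * d) (by
    have := hN.left_symm u v v
    simp only [smul_mul_assoc, mul_smul_comm, h₂₂, h₁₂, h₂₁] at this
    rw [← sub_eq_zero] at this
    rw [← this]; module)
  by_cases hb : b = 0
  · by_cases hc : c = 0
    · subst hb hc
      have key (p q r s : ℂ) (h : p * s ≠ q * r) := isomorphic_tableAlg_of_linearIndependent hd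
        ((LinearIndependent.pair_add_smul_add_smul_iff p q r s).2 ⟨he, h⟩)
      simp only [add_mul, mul_add, smul_mul_assoc, mul_smul_comm, h₁₁, h₁₂, h₂₁, h₂₂] at key
      by_cases ha : a = 0
      · by_cases hd0 : d = 0
        · subst ha hd0
          obtain ⟨x, y, hxy⟩ := h0
          exact absurd (mul_eq_zero_of_basis hd he (by simp [h₁₁]) (by simp [h₁₂])
            (by simp [h₂₁]) (by simp [h₂₂]) x y) hxy
        · subst ha
          refine ⟨.N07, trivial, key 0 d⁻¹ 1 0 (by simp [eq_comm, hd0]) _ ?_ ?_ ?_ ?_⟩ <;>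
          simp [Entry.table, e₁] <;> match_scalars <;> field_simp
      · by_cases hd0 : d = 0
        · subst hd0
          refine ⟨.N07, trivial, key a⁻¹ 0 0 1 (by simp [ha]) _ ?_ ?_ ?_ ?_⟩ <;>
          simp [Entry.table, e₁] <;> match_scalars <;> field_simp
        · refine ⟨.N11, trivial, key a⁻¹ 0 0 d⁻¹ (by simp [ha, hd0]) _ ?_ ?_ ?_ ?_⟩ <;>
          simp [Entry.table, e₁, e₂] <;> match_scalars <;> field_simp
    · have hb' : b = δ * d := mul_left_cancel₀ hc (by linear_combination h4)
      have ha' : a = δ * c := mul_left_cancel₀ hc (by linear_combination h2)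
      refine classification_diagonal_of_ne_zero hd (LinearIndependent.pair_symm_iff.1 he)
        h₂₂ h₂₁ h₁₂ h₁₁ hc hb' ha' ?_
      rw [← hb', hb]; ring
  · have hd' : d = δ * b := mul_left_cancel₀ hb (by linear_combination -h3)
    have hc' : c = δ * a := mul_left_cancel₀ hb (by linear_combination -h1)
    refine classification_diagonal_of_ne_zero hd he h₁₁ h₁₂ h₂₁ h₂₂ hb hc' hd' ?_
    rw [hc', hd'] at h4
    refine (mul_eq_zero.1 (?_ : b * (δ * a * (δ - 1) * (δ + 1)) = 0)).resolve_left hb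
    linear_combination -h4

/-- Algebras in which all right multiplications are lower triangular in a common basis, with a
single eigenvalue each. Once `c` and `d` are not both zero, `δ`-left symmetry forces `b = 0` and
`(δ - 1) * (d - a) * a = 0`. -/
theorem classification_jordan {δ : ℂ} (hd : Module.finrank ℂ N = 2)
    (hN : IsDeltaNovikov δ N) (h0 : ∃ x y : N, x * y ≠ 0)
    {u v : N} (he : LinearIndependent ℂ ![u, v])
    {a b c d : ℂ} (h₁₁ : u * u = a • u + c • v) (h₁₂ : u * v = b • u + d • v)
    (h₂₁ : v * u = a • v) (h₂₂ : v * v = b • v) :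
    ∃ E : Entry, δ ∈ E.mark ∧ Isomorphic N E.Alg := by
  by_cases hcd : c = 0 ∧ d = 0
  · obtain ⟨rfl, rfl⟩ := hcd
    simp only [zero_smul, add_zero] at h₁₁ h₁₂
    exact classification_diagonal hd hN h0 he h₁₁ h₁₂ h₂₁ h₂₂
  have he' := LinearIndependent.pair_iff.1 he
  obtain ⟨h1, h2⟩ := he' ((δ - 1) * b * a) ((δ + 1) * b * c + (δ - 1) * (d - a) * a) (by
    have := hN.left_symm u v u
    simp only [add_mul, mul_add, smul_mul_assoc, mul_smul_comm, h₁₁, h₁₂, h₂₁, h₂₂] at this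
    rw [← sub_eq_zero] at this
    rw [← this]; module)
  obtain ⟨h3, h4⟩ := he' ((δ - 1) * b * b) ((δ + 1) * b * d + (δ - 1) * (d - a) * b) (by
    have := hN.left_symm u v v
    simp only [add_mul, mul_add, smul_mul_assoc, mul_smul_comm, h₁₂, h₂₁, h₂₂] at this
    rw [← sub_eq_zero] at this
    rw [← this]; module)
  obtain rfl : b = 0 := by
    by_contra hb
    obtain rfl : δ = 1 := by simpa [hb, sub_eq_zero] using h3
    exact hcd ⟨by simpa [hb, one_add_one_eq_two] using h2,
      by simpa [hb, one_add_one_eq_two] using h4⟩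
  have key (p q r s : ℂ) (h : p * s ≠ q * r) := isomorphic_tableAlg_of_linearIndependent hd
    ((LinearIndependent.pair_add_smul_add_smul_iff p q r s).2 ⟨he, h⟩)
  simp only [add_mul, mul_add, smul_mul_assoc, mul_smul_comm, h₁₁, h₁₂, h₂₁, h₂₂] at key
  by_cases ha : a = 0
  · subst ha
    by_cases hd0 : d = 0
    · subst hd0
      have hc : c ≠ 0 := fun h => hcd ⟨h, rfl⟩
      refine ⟨.N02, trivial, key 1 0 0 c (by simpa) _ ?_ ?_ ?_ ?_⟩ <;>
      simp [Entry.table, e₂]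
    · refine ⟨.N04, trivial, key 0 1 d⁻¹ (-(c / d) * d⁻¹) (by simp [eq_comm, hd0]) _ ?_ ?_ ?_ ?_⟩ <;>
      simp [Entry.table, e₁] <;> match_scalars <;> field_simp <;> ring
  -- the vector `a⁻¹ • (u + t • v)` is idempotent if and only if `c + t * d = 0`
  by_cases hda : d = a
  · subst hda
    refine ⟨.N09, trivial, key d⁻¹ (-(c / d) * d⁻¹) 0 1 (by simp [ha]) _ ?_ ?_ ?_ ?_⟩ <;>
    simp [Entry.table, e₁, e₂] <;> match_scalars <;> field_simp <;> ring
  obtain rfl : δ = 1 := by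
    simpa [ha, sub_eq_zero, hda] using h2
  by_cases hd0 : d = 0
  · subst hd0
    have hc : c ≠ 0 := fun h => hcd ⟨h, rfl⟩
    refine ⟨.N01, rfl, key a⁻¹ 0 0 (c / a ^ 2) (by simp [ha, hc]) _ ?_ ?_ ?_ ?_⟩ <;>
    simp [Entry.table, e₁, e₂] <;> match_scalars <;> field_simp
  · refine ⟨.N10 (d / a) (by rwa [Ne, div_eq_one_iff_eq ha]), rfl,
      key a⁻¹ (-(c / d) * a⁻¹) 0 1 (by simp [ha]) _ ?_ ?_ ?_ ?_⟩ <;>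
    simp [Entry.table, e₁, e₂] <;> match_scalars <;> field_simp <;> ring

/-- A two-dimensional `δ`-Novikov algebra with nonzero multiplication is isomorphic to an entry of
the list marked with `δ`. -/
theorem classification {δ : ℂ} (hd : Module.finrank ℂ N = 2) (h0 : ∃ x y : N, x * y ≠ 0)
    (hN : IsDeltaNovikov δ N) : ∃ E : Entry, δ ∈ E.mark ∧ Isomorphic N E.Alg := by
  obtain ⟨u, v, he, h | h⟩ := exists_basis_diagonal_or_jordan hd hN
  · obtain ⟨_, _, h₁₁, h₂₁⟩ := h u
    obtain ⟨_, _, h₁₂, h₂₂⟩ := h v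
    exact classification_diagonal hd hN h0 he h₁₁ h₁₂ h₂₁ h₂₂
  · obtain ⟨_, _, h₁₁, h₂₁⟩ := h u
    obtain ⟨_, _, h₁₂, h₂₂⟩ := h v
    exact classification_jordan hd hN h0 he h₁₁ h₁₂ h₂₁ h₂₂

end Basis

/-! ### The marks -/

theorem TableAlg.sub_apply (T : Matrix (Fin 2) (Fin 2) (Fin 2 → ℂ)) (x y : TableAlg T)
    (k : Fin 2) : (x - y) k = x k - y k := rfl

namespace Entry

/-- The marks are necessary: `γ`-left symmetry of the triples `(e₁, e₂, e₁)` and `(e₁, e₂, e₂)`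
already determines them. -/
theorem mem_mark_of_isDeltaNovikov {E : Entry} {γ : ℂ} (h : IsDeltaNovikov γ E.Alg) :
    γ ∈ E.mark := by
  have key (x y z : E.Alg) (k : Fin 2) := congrFun (h.left_symm x y z) k
  simp only [TableAlg.sub_apply, TableAlg.smul_apply, TableAlg.mul_apply, Fin.sum_univ_two,
    Fin.forall_fin_two] at key
  have h₁ := key e₁ e₂ e₁
  have h₂ := key e₁ e₂ e₂
  clear key
  cases E <;> simp only [mark, Set.mem_univ, Set.mem_singleton_iff] <;>
    simp [table, e₁, e₂] at h₁ h₂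
  case N01 => linear_combination -h₁
  case N03 => exact h₂
  case N05 => exact h₁
  case N06 => linear_combination -h₁
  case N08 γ' hγ' =>
    field_simp at h₁
    linear_combination -h₁
  case N10 α hα =>
    exact mul_right_cancel₀ (sub_ne_zero.2 hα) (by linear_combination h₁)
  case N12 => linear_combination h₂.1

theorem isDeltaNovikov_of_mem_mark {E : Entry} {γ : ℂ} (h : γ ∈ E.mark) :
    IsDeltaNovikov γ E.Alg := by
  constructor
  -- the cancellation lemmas are disabled so that the goals stay polynomial identities for `ring`
  · intro x y z
    funext k
    simp only [TableAlg.sub_apply, TableAlg.smul_apply, TableAlg.mul_apply, Fin.sum_univ_two]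
    cases E <;> simp only [mark, Set.mem_singleton_iff] at h <;> try subst h
    all_goals fin_cases k <;>
      simp [table, e₁, e₂, -mul_eq_mul_left_iff, -mul_eq_mul_right_iff, -mul_eq_zero]
    all_goals try field_simp
    all_goals try ring
  · intro x y z
    funext k
    simp only [TableAlg.mul_apply, Fin.sum_univ_two]
    cases E <;> fin_cases k <;>
      simp [table, e₁, e₂, -mul_eq_mul_left_iff, -mul_eq_mul_right_iff, -mul_eq_zero]
    all_goals try ring

/-! ### The simple anti-Novikov algebra -/

/-- The product of the last entry is `x * y = l(y) σ(x)` with the linear form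
`l(y) = y 0 - y 1` and the reflection `σ(x) = (x 0, -x 1)`. -/
theorem N12_mul_apply (x y : N12.Alg) :
    (x * y) 0 = (y 0 - y 1) * x 0 ∧ (x * y) 1 = -((y 0 - y 1) * x 1) := by
  constructor <;> simp [TableAlg.mul_apply, table, Fin.sum_univ_two, e₁, e₂] <;> ring

theorem isSimpleAlg_N12 : IsSimpleAlg N12.Alg where
  mul_ne_zero := by
    refine ⟨e₁, e₁, fun h => ?_⟩
    have h0 := (N12_mul_apply e₁ e₁).1.symm.trans (congrFun h 0)
    simp [e₁, TableAlg.zero_apply] at h0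
  ideal_eq I hI := by
    -- the products `a * x` exhaust the algebra as soon as `x 0 ≠ x 1`
    have htop (x : N12.Alg) (hx : x ∈ I) (h : x 0 - x 1 ≠ 0) : I = ⊤ := by
      rw [eq_top_iff]
      intro v _
      let a : N12.Alg := (![v 0 / (x 0 - x 1), -(v 1 / (x 0 - x 1))] : Fin 2 → ℂ)
      have ha₀ : a 0 = v 0 / (x 0 - x 1) := rfl
      have ha₁ : a 1 = -(v 1 / (x 0 - x 1)) := rfl
      have hv : a * x = v := by
        funext k
        fin_cases k
        · refine (N12_mul_apply a x).1.trans ?_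
          rw [ha₀, mul_div_cancel₀ _ h]; rfl
        · refine (N12_mul_apply a x).2.trans ?_
          rw [ha₁, mul_neg, neg_neg, mul_div_cancel₀ _ h]; rfl
      exact hv ▸ (hI x hx a).1
    rcases eq_or_ne I ⊥ with h | h
    · exact Or.inl h
    right
    obtain ⟨x, hx, hx0⟩ := I.exists_mem_ne_zero_of_ne_bot h
    by_cases h : x 0 - x 1 = 0
    · -- then `x * e₁` has the coordinates `x 0` and `-x 1`, which differ as `x ≠ 0`
      have hxe := N12_mul_apply x e₁
      refine htop _ (hI x hx e₁).2 fun h' => hx0 ?_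
      rw [hxe.1, hxe.2] at h'
      simp only [e₁, Matrix.cons_val_zero, Matrix.cons_val_one] at h'
      funext k
      fin_cases k
      · change x 0 = 0
        linear_combination h / 2 + h' / 2
      · change x 1 = 0
        linear_combination -h / 2 + h' / 2
    · exact htop x hx h

theorem N12_not_commutative : ∃ x y : N12.Alg, x * y ≠ y * x := by
  refine ⟨e₁, e₂, fun h => ?_⟩
  have h0 := (N12_mul_apply e₁ e₂).1.symm.trans ((congrFun h 0).trans (N12_mul_apply e₂ e₁).1)
  simp [e₁, e₂] at h0

end Entry

end DeltaNovikov

theorem mainTheorem5 :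
    -- the classification, for every `δ`
    (∀ (δ : ℂ) (N : Type*) [NonUnitalNonAssocRing N] [Module ℂ N] [IsScalarTower ℂ N N]
        [SMulCommClass ℂ N N],
        Module.finrank ℂ N = 2 → (∃ x y : N, x * y ≠ 0) → DeltaNovikov.IsDeltaNovikov δ N →
        ∃ E : DeltaNovikov.Entry, δ ∈ E.mark ∧ DeltaNovikov.Isomorphic N E.Alg) ∧
    -- each entry is `γ`-Novikov precisely for those `γ` with which it is marked
    (∀ (E : DeltaNovikov.Entry) (γ : ℂ), DeltaNovikov.IsDeltaNovikov γ E.Alg ↔ γ ∈ E.mark) ∧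
    -- the last entry is a simple non-commutative anti-Novikov algebra
    (DeltaNovikov.IsDeltaNovikov (-1) DeltaNovikov.Entry.N12.Alg ∧
      DeltaNovikov.IsSimpleAlg DeltaNovikov.Entry.N12.Alg ∧
      ∃ x y : DeltaNovikov.Entry.N12.Alg, x * y ≠ y * x) := by
  refine ⟨fun δ N _ _ _ _ hd h0 hN => DeltaNovikov.classification hd h0 hN,
    fun E γ => ⟨DeltaNovikov.Entry.mem_mark_of_isDeltaNovikov,
      DeltaNovikov.Entry.isDeltaNovikov_of_mem_mark⟩,
    DeltaNovikov.Entry.isDeltaNovikov_of_mem_mark rfl,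
    DeltaNovikov.Entry.isSimpleAlg_N12, DeltaNovikov.Entry.N12_not_commutative⟩
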